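/- For integers $p,q$ let $K(p,q)$ be the double twist knot or link, given by its standard diagram: a vertical column of $|p|$ half twists inside a disk, whose two ends at the top are joined to each other, and whose two ends at the bottom are joined to each other, by the two strands of a second column of $|q|$ half twists outside the disk. The half twists have the signs of $p$ and $q$, where a half twist is positive if it is a positive crossing when its two strands are oriented in the same direction along the column. The Kauffman bracket $\langle D\rangle\in\mathbb Z[A,A^{-1}]$ of a link diagram $D$ is normalized by $\langle\text{unknot}\rangle=1$ and $\langle D\sqcup\bigcirc\rangle=(-A^2-A^{-2})\langle D\rangle$, and at a positive crossing the smoothing that respects the orientation has weight $A^{-1}$ and the other one has weight $A$ (correspondingly with $A$ and $A^{-1}$ exchanged at a negative crossing). The Jones polynomial of an oriented link with diagram $D$ and writhe $w$ is obtained from $(-A^{-3})^{-w}\langle D\rangle$ by the substitution $A^4=t$. The span of a nonzero Laurent polynomial in $t$ (possibly with fractional exponents) is understood as its highest degree minus its lowest degree plus $1$. Let $p,q>1$ be integers. Then the lowest degree term of $\langle K(p,q)\rangle$ is $-A^{-p-q}$, and the highest degree term of $\langle K(p,q)\rangle$ is $(-1)^{p+q}A^{3(p+q)-4}$. Hence,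 for every orientation of $K(p,q)$, the span of the Jones polynomial of $K(p,q)$ is $p+q$. -/

import Mathlib

open scoped LaurentPolynomial

/-- An (unoriented) link diagram, given by its planar diagram code.
`Crossing` is the set of double points and `Arc` the set of arcs into which the double points cut
the diagram; a component without double points is a single arc (a free circle).
`strand c 0, strand c 1, strand c 2, strand c 3` are the arcs met when going counterclockwise
around the crossing `c`, where `strand c 0` and `strand c 2` form the strand passing *under*, and
`strand c 1` and `strand c 3` the strand passing *over*. -/
structure LinkDiagram where
  Crossing : Type
  Arc : Type
  [fintypeCrossing : Fintype Crossing]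
  [decEqCrossing : DecidableEq Crossing]
  [finiteArc : Finite Arc]
  [nonemptyArc : Nonempty Arc]
  strand : Crossing → Fin 4 → Arc
  /-- An arc has two ends at crossings, unless it is a free circle. -/
  two_ends : ∀ a : Arc, Nat.card {e : Crossing × Fin 4 // strand e.1 e.2 = a} = 0 ∨
    Nat.card {e : Crossing × Fin 4 // strand e.1 e.2 = a} = 2

namespace LinkDiagram

attribute [instance] fintypeCrossing decEqCrossing finiteArc nonemptyArc

/-! ### The Kauffman bracket -/

/-- A state `s` smooths every crossing in one of the two ways.
With `s c = true` the crossing `c` is replaced by two arcs, one joining ends `0` and `3`, the other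
joining ends `1` and `2`; with `s c = false` ends `0, 1` and ends `2, 3` are joined. -/
def Joined (D : LinkDiagram) (s : D.Crossing → Bool) (a b : D.Arc) : Prop :=
  ∃ c, if s c = true
    then (a = D.strand c 0 ∧ b = D.strand c 3) ∨ (a = D.strand c 1 ∧ b = D.strand c 2)
    else (a = D.strand c 0 ∧ b = D.strand c 1) ∨ (a = D.strand c 2 ∧ b = D.strand c 3)

/-- The number of circles obtained by smoothing the diagram according to the state `s`: the number
of classes of arcs for the equivalence relation generated by the joins. -/
noncomputable def loops (D : LinkDiagram) (s : D.Crossing → Bool) : ℕ :=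
  Nat.card (Quot (D.Joined s))

/-- The Kauffman bracket as a Laurent polynomial in `A` (`LaurentPolynomial.T n` is `A ^ n`), by the
state sum `⟨D⟩ = ∑ₛ A ^ (#true - #false) * (-A² - A⁻²) ^ (loops - 1)`.
Equivalently: `⟨unknot⟩ = 1`, `⟨D ⊔ circle⟩ = (-A² - A⁻²) ⟨D⟩`, and at a crossing
`⟨D⟩ = A ⟨D_true⟩ + A⁻¹ ⟨D_false⟩`. At a positive crossing of an oriented diagram the smoothing that
respects the orientation is the `false` one, with weight `A⁻¹`; this is the convention for which
the Jones polynomial is obtained by the substitution `t = A⁴`. -/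
noncomputable def bracket (D : LinkDiagram) : ℤ[T;T⁻¹] :=
  ∑ s : D.Crossing → Bool,
    (∏ c, if s c = true then LaurentPolynomial.T 1 else LaurentPolynomial.T (-1)) *
      (-LaurentPolynomial.T 2 - LaurentPolynomial.T (-2)) ^ (D.loops s - 1)

/-! ### The Jones polynomial -/

/-- An orientation of a link diagram: `incoming c i` says whether the end `i` of the crossing `c` is
directed towards `c`. Each strand runs straight through a crossing, and an arc that leaves a
crossing at one of its ends arrives at the other end. -/
structure Orientation (D : LinkDiagram) where
  incoming : D.Crossing → Fin 4 → Bool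
  through : ∀ c i, incoming c (i + 2) = !incoming c i
  along : ∀ c i c' i', (c, i) ≠ (c', i') → D.strand c i = D.strand c' i' →
    incoming c i ≠ incoming c' i'

/-- The sign of a crossing: `+1` if the overstrand has to be turned counterclockwise to get the
direction of the understrand, as happens when the understrand runs from `0` to `2` and the overstrand
from `3` to `1` (or both run backwards). -/
def Orientation.sign {D : LinkDiagram} (o : D.Orientation) (c : D.Crossing) : ℤ :=
  if o.incoming c 0 = o.incoming c 3 then 1 else -1

/-- The writhe of an oriented diagram. -/
def Orientation.writhe {D : LinkDiagram} (o : D.Orientation) : ℤ :=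
  ∑ c, o.sign c

/-- The normalized bracket `(-A⁻³) ^ (-w) ⟨D⟩ = (-1) ^ w A ^ (3w) ⟨D⟩`, where `w` is the writhe. -/
noncomputable def normalizedBracket (D : LinkDiagram) (o : D.Orientation) : ℤ[T;T⁻¹] :=
  LaurentPolynomial.C (o.writhe.negOnePow : ℤ) * LaurentPolynomial.T (3 * o.writhe) * D.bracket

/-- The Jones polynomial of the oriented link with diagram `D`, by the substitution `A⁴ = t` in the
normalized bracket: a Laurent polynomial in `t` with rational exponents. -/
noncomputable def jones (D : LinkDiagram) (o : D.Orientation) : AddMonoidAlgebra ℤ ℚ :=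
  AddMonoidAlgebra.mapDomain (fun n : ℤ => (n : ℚ) / 4) (D.normalizedBracket o)

/-! ### Double twist knots -/

/-- The crossing in a column of half twists lying between level `k` and level `k + 1`, where the left
and right strands of the column at level `j` (counted downwards) are the arcs `L j` and `R j`.
The ends are `R (k + 1)` (south-east), `R k` (north-east), `L k` (north-west) and `L (k + 1)`
(south-west), in counterclockwise order. The over strand runs from south-west to north-east if the
half twist is positive, so that the crossing is positive if both strands are directed downwards;
it runs from south-east to north-west if the half twist is negative. -/
def halfTwist {α : Type} (positive : Bool) (L R : ℕ → α) (k : ℕ) : Fin 4 → α :=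
  if positive then ![R (k + 1), R k, L k, L (k + 1)] else ![L (k + 1), R (k + 1), R k, L k]

/-- The number of arcs of the double twist diagram with `m` and `n` crossings; without crossings it is
one free circle. -/
def numArcs (m n : ℕ) : ℕ := max 1 (2 * (m + n))

instance (m n : ℕ) : NeZero (numArcs m n) := ⟨by unfold numArcs; omega⟩

/-- Arcs at the crossings of a double twist diagram whose two columns have `m` half twists of sign
`pos` and `n` half twists of sign `pos'`.
The first column lies inside a disk. Its four ends are `L 0, L m, R m, R 0`, in counterclockwise
order. The second column lies outside the disk (turned by a half turn of the sphere); its ends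
`L' 0, R' 0, R' n, L' n` are glued to `L 0, L m, R m, R 0`, respectively. So the strands of the
second column run from top to top and from bottom to bottom of the first column. Numbering
the arcs cyclically along the closed chain formed by `L`, `R'`, `R` (reversed) and `L'` (reversed),
one has
`L k = k`, `R' k = m + k`, `R k = 2 m + n - k`, `L' k = 2 m + 2 n - k` modulo `2 (m + n)`. -/
def doubleTwistStrand (m n : ℕ) (pos pos' : Bool) :
    Fin m ⊕ Fin n → Fin 4 → ZMod (numArcs m n)
  | .inl k => halfTwist pos (fun j => (j : ZMod (numArcs m n)))
      (fun j => 2 * m + n - j) k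
  | .inr k => halfTwist pos' (fun j => (2 * m + 2 * n - j : ZMod (numArcs m n)))
      (fun j => m + j) k

theorem sum_halfTwist {α : Type} [DecidableEq α] (b : Bool) (L R : ℕ → α) (k : ℕ) (a : α) :
    (∑ i, if halfTwist b L R k i = a then 1 else 0 : ℕ) =
      (if L k = a then 1 else 0) + (if L (k + 1) = a then 1 else 0) +
      ((if R (k + 1) = a then 1 else 0) + (if R k = a then 1 else 0)) := by
  rw [Fin.sum_univ_four]
  cases b
  · change (if L (k + 1) = a then 1 else 0) + (if R (k + 1) = a then 1 else 0) +
      (if R k = a then 1 else 0) + (if L k = a then 1 else 0) = _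
    ring
  · change (if R (k + 1) = a then 1 else 0) + (if R k = a then 1 else 0) +
      (if L k = a then 1 else 0) + (if L (k + 1) = a then 1 else 0) = _
    ring

theorem card_ends {C α : Type} [Fintype C] [DecidableEq α] (f : C → Fin 4 → α) (a : α) :
    Nat.card {e : C × Fin 4 // f e.1 e.2 = a} = ∑ c, ∑ i, if f c i = a then 1 else 0 := by
  rw [Nat.card_eq_fintype_card, Fintype.card_subtype, Finset.card_filter, Fintype.sum_prod_type]

theorem doubleTwist_two_ends (m n : ℕ) (pos pos' : Bool) (a : ZMod (numArcs m n))
    (h : 0 < m + n) :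
    Nat.card {e : (Fin m ⊕ Fin n) × Fin 4 // doubleTwistStrand m n pos pos' e.1 e.2 = a} = 2 := by
  classical
  have hN : numArcs m n = m + n + m + n := by unfold numArcs; omega
  have key : ∀ g : ZMod (numArcs m n) → ℕ,
      ∑ x : ZMod (numArcs m n), g x = ∑ j ∈ Finset.range (m + n + m + n), g (j : ℕ) := by
    intro g
    rw [← hN]
    refine (Finset.sum_bij (fun j _ => ((j : ℕ) : ZMod (numArcs m n))) (by simp) ?_ ?_
      (by simp)).symm
    · intro x hx y hy hxy
      have := (ZMod.natCast_eq_natCast_iff' x y _).1 hxy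
      rwa [Nat.mod_eq_of_lt (Finset.mem_range.1 hx), Nat.mod_eq_of_lt (Finset.mem_range.1 hy)]
        at this
    · intro y _
      exact ⟨y.val, Finset.mem_range.2 (ZMod.val_lt y), ZMod.natCast_zmod_val y⟩
  have one : ∀ b : ZMod (numArcs m n),
      ∑ x : ZMod (numArcs m n), (if x = b then 1 else 0 : ℕ) = 1 := by simp
  have tot : ∑ x : ZMod (numArcs m n),
      ((if x = a then 1 else 0) + (if x + 1 = a then 1 else 0) : ℕ) = 2 := by
    rw [Finset.sum_add_distrib, one]
    simp only [← eq_sub_iff_add_eq, one]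
  rw [card_ends, Fintype.sum_sum_type]
  change (∑ k : Fin m, ∑ i, if halfTwist pos (fun j => (j : ZMod (numArcs m n)))
      (fun j => 2 * m + n - j) k i = a then 1 else 0) +
    (∑ k : Fin n, ∑ i, if halfTwist pos' (fun j => (2 * m + 2 * n - j : ZMod (numArcs m n)))
      (fun j => m + j) k i = a then 1 else 0) = 2
  simp only [sum_halfTwist]
  rw [← tot, key, Finset.sum_range_add, Finset.sum_range_add, Finset.sum_range_add,
    Fin.sum_univ_eq_sum_range (fun k : ℕ =>
      ((if (k : ZMod (numArcs m n)) = a then 1 else 0) +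
        (if ((k + 1 : ℕ) : ZMod (numArcs m n)) = a then 1 else 0) +
        ((if (2 * m + n - (k + 1 : ℕ) : ZMod (numArcs m n)) = a then 1 else 0) +
        (if (2 * m + n - k : ZMod (numArcs m n)) = a then 1 else 0)) : ℕ)),
    Fin.sum_univ_eq_sum_range (fun k : ℕ =>
      ((if (2 * m + 2 * n - k : ZMod (numArcs m n)) = a then 1 else 0) +
        (if (2 * m + 2 * n - (k + 1 : ℕ) : ZMod (numArcs m n)) = a then 1 else 0) +
        ((if (m + (k + 1 : ℕ) : ZMod (numArcs m n)) = a then 1 else 0) +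
        (if (m + k : ZMod (numArcs m n)) = a then 1 else 0)) : ℕ))]
  rw [Finset.sum_add_distrib (s := Finset.range m), Finset.sum_add_distrib (s := Finset.range n)]
  have e1 : ∑ k ∈ Finset.range m,
      ((if (2 * m + n - (k + 1 : ℕ) : ZMod (numArcs m n)) = a then 1 else 0) +
        (if (2 * m + n - k : ZMod (numArcs m n)) = a then 1 else 0) : ℕ) =
      ∑ k ∈ Finset.range m, ((if ((m + n + k : ℕ) : ZMod (numArcs m n)) = a then 1 else 0) +
        (if ((m + n + k : ℕ) : ZMod (numArcs m n)) + 1 = a then 1 else 0) : ℕ) := by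
    rw [← Finset.sum_range_reflect]
    refine Finset.sum_congr rfl fun k hk => ?_
    have hk := Finset.mem_range.1 hk
    have : ((m - 1 - k : ℕ) : ZMod (numArcs m n)) = m - 1 - k := by
      rw [Nat.sub_sub, Nat.cast_sub (by omega)]; push_cast; ring
    push_cast
    rw [this]
    ring_nf
  have e2 : ∑ k ∈ Finset.range n,
      ((if (2 * m + 2 * n - k : ZMod (numArcs m n)) = a then 1 else 0) +
        (if (2 * m + 2 * n - (k + 1 : ℕ) : ZMod (numArcs m n)) = a then 1 else 0) : ℕ) =
      ∑ k ∈ Finset.range n,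
        ((if ((m + n + m + k : ℕ) : ZMod (numArcs m n)) = a then 1 else 0) +
        (if ((m + n + m + k : ℕ) : ZMod (numArcs m n)) + 1 = a then 1 else 0) : ℕ) := by
    rw [← Finset.sum_range_reflect]
    refine Finset.sum_congr rfl fun k hk => ?_
    have hk := Finset.mem_range.1 hk
    have : ((n - 1 - k : ℕ) : ZMod (numArcs m n)) = n - 1 - k := by
      rw [Nat.sub_sub, Nat.cast_sub (by omega)]; push_cast; ring
    push_cast
    rw [this]
    ring_nf
  rw [e1, e2]
  have e3 : ∑ k ∈ Finset.range n,
      ((if (m + (k + 1 : ℕ) : ZMod (numArcs m n)) = a then 1 else 0) +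
        (if (m + k : ZMod (numArcs m n)) = a then 1 else 0) : ℕ) =
      ∑ k ∈ Finset.range n, ((if ((m + k : ℕ) : ZMod (numArcs m n)) = a then 1 else 0) +
        (if ((m + k : ℕ) : ZMod (numArcs m n)) + 1 = a then 1 else 0) : ℕ) := by
    refine Finset.sum_congr rfl fun k _ => ?_
    push_cast
    ring_nf
  rw [e3]
  push_cast
  ring

/-- The standard diagram of the double twist knot (or link) `K(p,q)`: a column of `|p|` half twists of
the sign of `p` and a column of `|q|` half twists of the sign of `q`, glued as described at
`doubleTwistStrand`. -/
def doubleTwist (p q : ℤ) : LinkDiagram where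
  Crossing := Fin p.natAbs ⊕ Fin q.natAbs
  Arc := ZMod (numArcs p.natAbs q.natAbs)
  strand := doubleTwistStrand p.natAbs q.natAbs (decide (0 < p)) (decide (0 < q))
  two_ends a := by
    rcases Nat.eq_zero_or_pos (p.natAbs + q.natAbs) with h | h
    · left
      have : IsEmpty (Fin p.natAbs ⊕ Fin q.natAbs) := by
        rw [isEmpty_sum]
        constructor <;> constructor <;> intro k <;> have := k.isLt <;> omega
      exact Nat.card_of_isEmpty
    · exact Or.inr (doubleTwist_two_ends _ _ _ _ a h)

end LinkDiagram

/-! ### Extreme terms and span of a Laurent polynomial -/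

section Terms

variable {Γ : Type} [AddMonoid Γ] [LinearOrder Γ]

/-- The lowest degree term of the Laurent polynomial `f` is `c x ^ n`. -/
def IsLowestTerm (f : AddMonoidAlgebra ℤ Γ) (n : Γ) (c : ℤ) : Prop :=
  IsLeast {m | f.coeff m ≠ 0} n ∧ f.coeff n = c

/-- The highest degree term of the Laurent polynomial `f` is `c x ^ n`. -/
def IsHighestTerm (f : AddMonoidAlgebra ℤ Γ) (n : Γ) (c : ℤ) : Prop :=
  IsGreatest {m | f.coeff m ≠ 0} n ∧ f.coeff n = c

end Terms

/-- The span of a nonzero Laurent polynomial `f` is `s`, where the span is understood as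
`(highest degree) - (lowest degree) + 1`. -/
def HasSpan (f : AddMonoidAlgebra ℤ ℚ) (s : ℚ) : Prop :=
  ∃ a b : ℚ, IsLeast {m | f.coeff m ≠ 0} a ∧ IsGreatest {m | f.coeff m ≠ 0} b ∧ s = b - a + 1

/-!
For a natural number `y`, the term `y ^ loops` of a state counts the colorings of its circles with
`y` colors. Exchanging the sums over states and colorings turns the state sum at the circle value
`y` into a partition function whose local weights are those of `b + a E`, with `E` the hook of the
Temperley-Lieb algebra on two strands. A double twist diagram pairs two powers of this element, and
`E ^ 2 = y E` gives a closed formula. Both sides are polynomials in the circle value, so it holds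
for every circle value. For the Kauffman bracket the geometric sums in it become sums of powers of
`-A ^ 4`, and the outermost terms of `A ^ 4 * (sum) * (sum)` survive when both columns have at
least two half twists.
-/

namespace LinkDiagram

variable {R : Type*} [CommSemiring R] {Y : Type*}

/-- The state sum of a link diagram with weights `a` and `b` of the two smoothings and with the
value `d` of a circle; the Kauffman bracket is its value at `a = A`, `b = A⁻¹`, `d = -A² - A⁻²`. -/
noncomputable def stateSum (D : LinkDiagram) (a b d : R) : R :=
  ∑ s : D.Crossing → Bool, (∏ c, if s c = true then a else b) * d ^ (D.loops s - 1)

theorem bracket_eq_stateSum (D : LinkDiagram) :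
    D.bracket = D.stateSum (LaurentPolynomial.T 1) (LaurentPolynomial.T (-1))
      (-LaurentPolynomial.T 2 - LaurentPolynomial.T (-2)) :=
  rfl

/-- The colors `x i` of the four ends of a crossing are constant on the two arcs of its smoothing
of type `t`, in the convention of `Joined`. -/
def RespectsSmoothing (t : Bool) (x : Fin 4 → Y) : Prop :=
  if t = true then x 0 = x 3 ∧ x 1 = x 2 else x 0 = x 1 ∧ x 2 = x 3

instance [DecidableEq Y] (t : Bool) (x : Fin 4 → Y) : Decidable (RespectsSmoothing t x) := by
  unfold RespectsSmoothing; infer_instance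

/-- The Boltzmann weight of a crossing whose four ends have the colors `x i`: the sum of the weights
of the smoothings that the coloring respects. -/
def crossingWeight [DecidableEq Y] (a b : R) (x : Fin 4 → Y) : R :=
  (if RespectsSmoothing true x then a else 0) + if RespectsSmoothing false x then b else 0

theorem forall_joined_imp_eq_iff (D : LinkDiagram) (s : D.Crossing → Bool) (F : D.Arc → Y) :
    (∀ i j, D.Joined s i j → F i = F j) ↔ ∀ c, RespectsSmoothing (s c) (F ∘ D.strand c) := by
  constructor
  · intro h c
    unfold RespectsSmoothing
    split_ifs with hs <;> exact ⟨h _ _ ⟨c, by simp [hs]⟩, h _ _ ⟨c, by simp [hs]⟩⟩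
  · rintro h i j ⟨c, hc⟩
    have hF := h c
    unfold RespectsSmoothing at hF
    split_ifs at hc hF <;> rcases hc with ⟨rfl, rfl⟩ | ⟨rfl, rfl⟩
    exacts [hF.1, hF.2, hF.1, hF.2]

theorem loops_pos (D : LinkDiagram) (s : D.Crossing → Bool) : 0 < D.loops s :=
  have : Finite (Quot (D.Joined s)) := Quot.finite _
  have : Nonempty (Quot (D.Joined s)) := D.nonemptyArc.map (Quot.mk _)
  Nat.card_pos

variable [Fintype Y]

theorem card_pow_card_quot {A : Type*} (rel : A → A → Prop) [Finite (Quot rel)] :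
    Fintype.card Y ^ Nat.card (Quot rel) =
      Nat.card {F : A → Y // ∀ i j, rel i j → F i = F j} := by
  rw [← Nat.card_eq_fintype_card, ← Nat.card_fun]
  exact Nat.card_congr
    { toFun := fun g => ⟨g ∘ Quot.mk rel, fun _ _ h => congrArg g (Quot.sound h)⟩
      invFun := fun F => Quot.lift F.1 F.2
      left_inv := fun g => funext <| Quot.ind fun _ => rfl
      right_inv := fun _ => rfl }

variable [DecidableEq Y]

theorem card_pow_loops (D : LinkDiagram) [Fintype D.Arc] [DecidableEq D.Arc]
    (s : D.Crossing → Bool) :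
    (Fintype.card Y : R) ^ D.loops s =
      ∑ F : D.Arc → Y, ∏ c, if RespectsSmoothing (s c) (F ∘ D.strand c) then 1 else 0 := by
  have : Finite (Quot (D.Joined s)) := Quot.finite _
  rw [← Nat.cast_pow, loops, card_pow_card_quot]
  simp only [forall_joined_imp_eq_iff, Fintype.prod_boole, Finset.sum_boole,
    Nat.card_eq_fintype_card, Fintype.card_subtype]

theorem card_mul_stateSum_card (D : LinkDiagram) [Fintype D.Arc] [DecidableEq D.Arc] (a b : R) :
    (Fintype.card Y : R) * D.stateSum a b (Fintype.card Y) =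
      ∑ F : D.Arc → Y, ∏ c, crossingWeight a b (F ∘ D.strand c) := by
  calc (Fintype.card Y : R) * D.stateSum a b (Fintype.card Y)
    _ = ∑ s : D.Crossing → Bool,
          (∏ c, if s c = true then a else b) * (Fintype.card Y : R) ^ D.loops s := by
      rw [stateSum, Finset.mul_sum]
      refine Finset.sum_congr rfl fun s _ => ?_
      rw [mul_left_comm, mul_pow_sub_one (D.loops_pos s).ne']
    _ = ∑ F : D.Arc → Y, ∑ s : D.Crossing → Bool, ∏ c,
          (if s c = true then a else b) *
            if RespectsSmoothing (s c) (F ∘ D.strand c) then 1 else 0 := by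
      simp only [card_pow_loops, Finset.mul_sum, Finset.prod_mul_distrib]
      exact Finset.sum_comm
    _ = ∑ F : D.Arc → Y, ∏ c, crossingWeight a b (F ∘ D.strand c) := by
      refine Finset.sum_congr rfl fun F _ => ?_
      have h := Finset.prod_univ_sum (fun _ : D.Crossing => Finset.univ) fun c (t : Bool) =>
        (if t = true then a else b) * if RespectsSmoothing t (F ∘ D.strand c) then 1 else 0
      rw [Fintype.piFinset_univ] at h
      simpa [crossingWeight] using h.symm

end LinkDiagram

section TransferMatrix

variable {R : Type*} [CommSemiring R] {Y : Type*} [Fintype Y] [DecidableEq Y]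

theorem sum_sum_pow_apply_mul {X : Type*} [Fintype X] [DecidableEq X] (M : Matrix X X R) (m : ℕ)
    (f : X → X → R) :
    ∑ x, ∑ y, (M ^ m) x y * f x y =
      ∑ g : Fin (m + 1) → X,
        (∏ k : Fin m, M (g k.castSucc) (g k.succ)) * f (g 0) (g (Fin.last m)) := by
  induction m generalizing f with
  | zero =>
    rw [← (Equiv.funUnique (Fin 1) X).symm.sum_comp]
    simp [Matrix.one_apply]
  | succ m ih =>
    rw [← (Fin.consEquiv fun _ => X).sum_comp, Fintype.sum_prod_type]
    refine Finset.sum_congr rfl fun x _ => ?_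
    simp only [Fin.consEquiv_apply, Fin.prod_univ_succ, Fin.castSucc_zero, Fin.cons_zero,
      Fin.cons_succ, ← Fin.succ_castSucc, ← Fin.succ_last]
    have h := ih fun y z => M x y * f x z
    simp only [pow_succ', Matrix.mul_apply, Finset.sum_mul]
    rw [Finset.sum_comm]
    convert h using 2
    · exact Finset.sum_congr rfl fun z _ => by ring
    · ring

variable (R Y) in
/-- The hook (cup-cap) `E` of the Temperley-Lieb algebra on two strands, acting on pairs of colors:
the two colors on top agree, and so do the two colors at the bottom. -/
def hook : Matrix (Y × Y) (Y × Y) R :=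
  Matrix.of fun x y => if x.1 = x.2 ∧ y.1 = y.2 then 1 else 0

theorem hook_mul_hook : hook R Y * hook R Y = (Fintype.card Y : R) • hook R Y := by
  ext x y
  by_cases hx : x.1 = x.2 <;> by_cases hy : y.1 = y.2 <;>
    simp [hook, Matrix.mul_apply, hx, hy, Fintype.sum_prod_type]

/-- The coefficient of the hook `E` in the expansion of `(b + a E) ^ m`, where `E ^ 2 = d E`. -/
def hookCoeff (a b d : R) (m : ℕ) : R :=
  a * ∑ i ∈ Finset.range m, b ^ i * (b + a * d) ^ (m - 1 - i)

theorem hookCoeff_succ (a b d : R) (m : ℕ) :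
    hookCoeff a b d (m + 1) = a * b ^ m + (b + a * d) * hookCoeff a b d m := by
  have h : ∑ i ∈ Finset.range m, b ^ i * (b + a * d) ^ (m - i) =
      (b + a * d) * ∑ i ∈ Finset.range m, b ^ i * (b + a * d) ^ (m - 1 - i) := by
    rw [Finset.mul_sum]
    refine Finset.sum_congr rfl fun i hi => ?_
    rw [mul_left_comm, ← pow_succ', Nat.sub_right_comm,
      Nat.sub_add_cancel (Nat.sub_pos_of_lt (Finset.mem_range.1 hi))]
  rw [hookCoeff, hookCoeff, Nat.add_sub_cancel, Finset.sum_range_succ, Nat.sub_self, h]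
  ring

theorem pow_smul_one_add_smul {S : Type*} [Semiring S] [Algebra R S] {a b d : R} {e : S}
    (he : e * e = d • e) (m : ℕ) :
    (b • (1 : S) + a • e) ^ m = b ^ m • (1 : S) + hookCoeff a b d m • e := by
  induction m with
  | zero => simp [hookCoeff]
  | succ m ih =>
    rw [pow_succ, ih, hookCoeff_succ]
    simp only [add_mul, mul_add, smul_mul_smul_comm, one_mul, mul_one, he]
    module

/-- The closure of a matrix `M` acting on pairs of colors inside the disk by a matrix `N`
acting on pairs of colors outside the disk. The second factor reads the colors of the four boundary
points after a quarter turn. -/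
def closurePairing (M N : Matrix (Y × Y) (Y × Y) R) : R :=
  ∑ x, ∑ y, M x y * N (x.1, y.1) (x.2, y.2)

theorem closurePairing_one_add_hook (α β α' β' : R) :
    closurePairing (α • (1 : Matrix (Y × Y) (Y × Y) R) + β • hook R Y) (α' • 1 + β' • hook R Y) =
      Fintype.card Y * (α * α' + β * β' + Fintype.card Y * (α * β' + β * α')) := by
  have turn_one (x y : Y × Y) :
      (1 : Matrix (Y × Y) (Y × Y) R) (x.1, y.1) (x.2, y.2) = hook R Y x y := by
    simp [hook, Matrix.one_apply]
  have turn_hook (x y : Y × Y) :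
      hook R Y (x.1, y.1) (x.2, y.2) = (1 : Matrix (Y × Y) (Y × Y) R) x y := by
    simp [hook, Matrix.one_apply, Prod.ext_iff]
  have sum_one_mul (f : Y × Y → Y × Y → R) :
      ∑ x, ∑ y, (1 : Matrix (Y × Y) (Y × Y) R) x y * f x y = ∑ x, f x x := by
    simp [Matrix.one_apply]
  have sum_hook_mul (f : Y × Y → Y × Y → R) :
      ∑ x, ∑ y, hook R Y x y * f x y = ∑ i, ∑ j, f (i, i) (j, j) := by
    simp only [hook, Matrix.of_apply, ite_and, Fintype.sum_prod_type, ite_mul, one_mul, zero_mul,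
      Finset.sum_ite_irrel, Finset.sum_const_zero, Finset.sum_ite_eq, Finset.mem_univ, if_true]
  simp only [closurePairing, Matrix.add_apply, Matrix.smul_apply, smul_eq_mul, turn_one, turn_hook,
    add_mul, mul_assoc, Finset.sum_add_distrib, ← Finset.mul_sum, sum_one_mul, sum_hook_mul]
  simp [hook, Matrix.one_apply, Fintype.sum_prod_type, ite_and]
  ring

end TransferMatrix

namespace LinkDiagram

section Gluing

variable {R : Type*} [CommSemiring R] {Y : Type*}

theorem crossingWeight_halfTwist [DecidableEq Y] (a b : R) {A : Type} (left right : ℕ → A)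
    (F : A → Y) (k : ℕ) :
    crossingWeight a b (F ∘ halfTwist true left right k) =
      (b • (1 : Matrix (Y × Y) (Y × Y) R) + a • hook R Y)
        (F (left k), F (right k)) (F (left (k + 1)), F (right (k + 1))) := by
  simp [crossingWeight, RespectsSmoothing, halfTwist, hook, Matrix.one_apply, add_comm,
    and_comm, eq_comm]

theorem two_mul_add_two_mul_eq_zero (m n : ℕ) : (2 * m + 2 * n : ZMod (numArcs m n)) = 0 := by
  rcases (m + n).eq_zero_or_pos with h | h
  · obtain ⟨rfl, rfl⟩ := Nat.add_eq_zero_iff.1 h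
    simp
  · have := ZMod.natCast_self (numArcs m n)
    rw [show numArcs m n = 2 * m + 2 * n by unfold numArcs; omega] at this ⊢
    exact_mod_cast this

theorem exists_eq_natCast_level {m n : ℕ} (a : ZMod (numArcs m n)) :
    (∃ k ≤ m, a = (k : ℕ) ∨ a = 2 * m + n - (k : ℕ)) ∨
      ∃ k ≤ n, a = 2 * m + 2 * n - (k : ℕ) ∨ a = m + (k : ℕ) := by
  have hlt := a.val_lt
  rw [← ZMod.natCast_zmod_val a]
  generalize a.val = v at hlt
  unfold numArcs at hlt
  by_cases h1 : v ≤ m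
  · exact .inl ⟨v, h1, .inl rfl⟩
  by_cases h2 : v ≤ m + n
  · exact .inr ⟨v - m, by omega, .inr (by rw [Nat.cast_sub (by omega)]; ring)⟩
  by_cases h3 : v ≤ 2 * m + n
  · exact .inl ⟨2 * m + n - v, by omega, .inr (by rw [Nat.cast_sub h3]; push_cast; ring)⟩
  · exact .inr ⟨2 * m + 2 * n - v, by omega,
      .inl (by rw [Nat.cast_sub (by omega)]; push_cast; ring)⟩

theorem exists_forall_natCast_eq {m n : ℕ} (Φ : ℕ → Y) (hΦ : Φ (2 * m + 2 * n) = Φ 0) :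
    ∃ F : ZMod (numArcs m n) → Y, ∀ v ≤ 2 * m + 2 * n, F (v : ℕ) = Φ v := by
  refine ⟨fun a => Φ a.val, fun v hv => ?_⟩
  rcases hv.eq_or_lt with rfl | hv
  · push_cast
    rw [two_mul_add_two_mul_eq_zero, ZMod.val_zero, hΦ]
  · change Φ (v : ZMod (numArcs m n)).val = Φ v
    rw [ZMod.val_natCast, Nat.mod_eq_of_lt (by unfold numArcs; omega)]

/-- Colors `g k` of the two strands of the first column at level `k` and colors `h k` of the two
strands of the second column agree where the columns of a double twist diagram are glued. -/
def IsGlued {m n : ℕ} (g : Fin (m + 1) → Y × Y) (h : Fin (n + 1) → Y × Y) : Prop :=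
  ((g 0).1, (g (Fin.last m)).1) = h 0 ∧ ((g 0).2, (g (Fin.last m)).2) = h (Fin.last n)

instance [DecidableEq Y] {m n : ℕ} (g : Fin (m + 1) → Y × Y) (h : Fin (n + 1) → Y × Y) :
    Decidable (IsGlued g h) := by
  unfold IsGlued; infer_instance

/-- The colors of the two strands of each column of a double twist diagram, level by level, in a
coloring of its arcs. -/
def columnColors {m n : ℕ} (F : ZMod (numArcs m n) → Y) :
    (Fin (m + 1) → Y × Y) × (Fin (n + 1) → Y × Y) :=
  (fun k => (F k.val, F (2 * m + n - k.val)), fun k => (F (2 * m + 2 * n - k.val), F (m + k.val)))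

theorem columnColors_injective (m n : ℕ) :
    Function.Injective (columnColors : (ZMod (numArcs m n) → Y) → _) := by
  intro F G hFG
  obtain ⟨h, h'⟩ := Prod.ext_iff.1 hFG
  funext a
  rcases exists_eq_natCast_level a with ⟨k, hk, ha⟩ | ⟨k, hk, ha⟩
  · have := congrFun h ⟨k, Nat.lt_succ_of_le hk⟩
    rcases ha with rfl | rfl
    exacts [congrArg Prod.fst this, congrArg Prod.snd this]
  · have := congrFun h' ⟨k, Nat.lt_succ_of_le hk⟩
    rcases ha with rfl | rfl
    exacts [congrArg Prod.fst this, congrArg Prod.snd this]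

/-- The closed chain of arcs of a double twist diagram runs down the left strand `l` of the first
column, along the right strand `r'` of the second, up the right strand `r` of the first and back
along the left strand `l'` of the second. -/
theorem exists_forall_level_eq {m n : ℕ} {l r l' r' : ℕ → Y} (h₁ : l 0 = l' 0) (h₂ : l m = r' 0)
    (h₃ : r 0 = l' n) (h₄ : r m = r' n) :
    ∃ F : ZMod (numArcs m n) → Y,
      (∀ k ≤ m, F (k : ℕ) = l k ∧ F (2 * m + n - (k : ℕ)) = r k) ∧
      ∀ k ≤ n, F (2 * m + 2 * n - (k : ℕ)) = l' k ∧ F (m + (k : ℕ)) = r' k := by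
  let Φ (v : ℕ) : Y := if v ≤ m then l v else if v ≤ m + n then r' (v - m) else
    if v ≤ 2 * m + n then r (2 * m + n - v) else l' (2 * m + 2 * n - v)
  have hl (k) (hk : k ≤ m) : Φ k = l k := if_pos hk
  have hr' (k) (hk : k ≤ n) : Φ (m + k) = r' k := by
    rcases k.eq_zero_or_pos with rfl | hk₀
    · exact (hl m le_rfl).trans h₂
    · simp only [Φ]
      rw [if_neg (by omega), if_pos (by omega), Nat.add_sub_cancel_left]
  have hr (k) (hk : k ≤ m) : Φ (2 * m + n - k) = r k := by
    rcases hk.eq_or_lt with rfl | hk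
    · rw [h₄, ← hr' n le_rfl]
      congr 1
      omega
    · simp only [Φ]
      rw [if_neg (by omega), if_neg (by omega), if_pos (by omega), Nat.sub_sub_self (by omega)]
  have hl' (k) (hk : k ≤ n) : Φ (2 * m + 2 * n - k) = l' k := by
    rcases hk.eq_or_lt with rfl | hk
    · rw [← h₃, ← hr 0 m.zero_le]
      congr 1
      omega
    · simp only [Φ]
      rw [if_neg (by omega), if_neg (by omega), if_neg (by omega), Nat.sub_sub_self (by omega)]
  obtain ⟨F, hF⟩ := exists_forall_natCast_eq Φ (show Φ (2 * m + 2 * n) = Φ 0 by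
    rw [hl 0 m.zero_le, h₁, ← hl' 0 n.zero_le, Nat.sub_zero])
  refine ⟨F, fun k hk => ⟨?_, ?_⟩, fun k hk => ⟨?_, ?_⟩⟩
  · rw [← hl k hk, hF k (by omega)]
  · rw [← hr k hk, ← hF _ (by omega), Nat.cast_sub (by omega)]
    push_cast
    rfl
  · rw [← hl' k hk, ← hF _ (by omega), Nat.cast_sub (by omega)]
    push_cast
    rfl
  · rw [← hr' k hk, ← hF _ (by omega), Nat.cast_add]

theorem exists_columnColors_eq {m n : ℕ} {g : Fin (m + 1) → Y × Y} {h : Fin (n + 1) → Y × Y}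
    (hgh : IsGlued g h) : ∃ F : ZMod (numArcs m n) → Y, columnColors F = (g, h) := by
  obtain ⟨htop, hbot⟩ := hgh
  rw [Prod.ext_iff] at htop hbot
  obtain ⟨F, hF, hF'⟩ := exists_forall_level_eq (m := m) (n := n)
    (l := fun k => (g (Fin.ofNat (m + 1) k)).1) (r := fun k => (g (Fin.ofNat (m + 1) k)).2)
    (l' := fun k => (h (Fin.ofNat (n + 1) k)).1) (r' := fun k => (h (Fin.ofNat (n + 1) k)).2)
    htop.1 (by simpa using htop.2) (by simpa using hbot.1) (by simpa using hbot.2)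
  refine ⟨F, Prod.ext (funext fun k => Prod.ext_iff.2 ?_) (funext fun k => Prod.ext_iff.2 ?_)⟩
  · simpa only [columnColors, Fin.ofNat_val_eq_self] using hF k (Nat.le_of_lt_succ k.isLt)
  · simpa only [columnColors, Fin.ofNat_val_eq_self] using hF' k (Nat.le_of_lt_succ k.isLt)

theorem isGlued_columnColors {m n : ℕ} (F : ZMod (numArcs m n) → Y) :
    IsGlued (columnColors F).1 (columnColors F).2 := by
  have h := two_mul_add_two_mul_eq_zero m n
  simp only [IsGlued, columnColors, Fin.val_zero, Fin.val_last, Prod.mk.injEq]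
  refine ⟨⟨?_, ?_⟩, ?_, ?_⟩ <;> congr 1
  · simp [h]
  · simp
  · simp; ring
  · ring

theorem sum_columnColors [Fintype Y] [DecidableEq Y] (m n : ℕ)
    (f : (Fin (m + 1) → Y × Y) → (Fin (n + 1) → Y × Y) → R) :
    ∑ F : ZMod (numArcs m n) → Y, f (columnColors F).1 (columnColors F).2 =
      ∑ g, ∑ h, if IsGlued g h then f g h else 0 := by
  rw [← Fintype.sum_prod_type']
  refine Fintype.sum_of_injective columnColors (columnColors_injective m n) _ _ ?_ fun F => ?_
  · rintro ⟨g, h⟩ hgh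
    exact if_neg fun hg => hgh (exists_columnColors_eq hg)
  · exact (if_pos (isGlued_columnColors F)).symm

theorem doubleTwist_natCast_strand_inl {m : ℕ} (n : ℕ) (k : Fin m) :
    (doubleTwist m n).strand (.inl k) =
      halfTwist true (fun j => (j : ZMod (numArcs m n))) (fun j => 2 * m + n - j) k := by
  rw [← decide_eq_true (Int.natCast_pos.2 k.pos)]
  rfl

theorem doubleTwist_natCast_strand_inr (m : ℕ) {n : ℕ} (k : Fin n) :
    (doubleTwist m n).strand (.inr k) =
      halfTwist true (fun j => (2 * m + 2 * n - j : ZMod (numArcs m n))) (fun j => m + j) k := by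
  rw [← decide_eq_true (Int.natCast_pos.2 k.pos)]
  rfl

variable [DecidableEq Y]

theorem prod_crossingWeight_doubleTwist (m n : ℕ) (a b : R) (F : ZMod (numArcs m n) → Y) :
    ∏ c, crossingWeight a b (F ∘ (doubleTwist m n).strand c) =
      (∏ k : Fin m, (b • (1 : Matrix (Y × Y) (Y × Y) R) + a • hook R Y)
        ((columnColors F).1 k.castSucc) ((columnColors F).1 k.succ)) *
      ∏ k : Fin n, (b • (1 : Matrix (Y × Y) (Y × Y) R) + a • hook R Y)
        ((columnColors F).2 k.castSucc) ((columnColors F).2 k.succ) := by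
  refine (Fintype.prod_sum_type fun c : Fin m ⊕ Fin n =>
    crossingWeight a b (F ∘ (doubleTwist m n).strand c)).trans ?_
  congr 1
  · refine Finset.prod_congr rfl fun k _ => ?_
    rw [doubleTwist_natCast_strand_inl]
    exact crossingWeight_halfTwist a b _ _ F k
  · refine Finset.prod_congr rfl fun k _ => ?_
    rw [doubleTwist_natCast_strand_inr]
    exact crossingWeight_halfTwist a b _ _ F k

variable [Fintype Y]

theorem sum_isGlued_prod_mul_prod (M N : Matrix (Y × Y) (Y × Y) R) (m n : ℕ) :
    (∑ g : Fin (m + 1) → Y × Y, ∑ h : Fin (n + 1) → Y × Y, if IsGlued g h then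
      (∏ k : Fin m, M (g k.castSucc) (g k.succ)) * ∏ k : Fin n, N (h k.castSucc) (h k.succ)
      else 0) = closurePairing (M ^ m) (N ^ n) := by
  rw [closurePairing, sum_sum_pow_apply_mul M m fun x y => (N ^ n) (x.1, y.1) (x.2, y.2)]
  refine Finset.sum_congr rfl fun g _ => ?_
  have h := sum_sum_pow_apply_mul N n fun x y =>
    if ((g 0).1, (g (Fin.last m)).1) = x ∧ ((g 0).2, (g (Fin.last m)).2) = y then (1 : R) else 0
  simp only [ite_and, mul_ite, mul_one, mul_zero, Finset.sum_ite_eq, Finset.mem_univ,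
    if_true, Finset.sum_ite_irrel, Finset.sum_const_zero] at h
  rw [h, Finset.mul_sum]
  refine Finset.sum_congr rfl fun h _ => ?_
  simp only [IsGlued, ite_and, mul_ite, mul_zero]

instance (p q : ℤ) : Fintype (doubleTwist p q).Arc :=
  inferInstanceAs (Fintype (ZMod (numArcs p.natAbs q.natAbs)))

instance (p q : ℤ) : DecidableEq (doubleTwist p q).Arc :=
  inferInstanceAs (DecidableEq (ZMod (numArcs p.natAbs q.natAbs)))

theorem card_mul_stateSum_doubleTwist_card (m n : ℕ) (a b : R) :
    (Fintype.card Y : R) * (doubleTwist m n).stateSum a b (Fintype.card Y) =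
      closurePairing ((b • (1 : Matrix (Y × Y) (Y × Y) R) + a • hook R Y) ^ m)
        ((b • (1 : Matrix (Y × Y) (Y × Y) R) + a • hook R Y) ^ n) := by
  rw [card_mul_stateSum_card, ← sum_isGlued_prod_mul_prod, ← sum_columnColors]
  exact Finset.sum_congr rfl fun F _ => prod_crossingWeight_doubleTwist m n a b F

end Gluing

theorem mul_stateSum_doubleTwist_natCast (m n : ℕ) {R : Type*} [CommSemiring R] (a b : R) (y : ℕ) :
    (y : R) * (doubleTwist m n).stateSum a b y =
      y * (b ^ m * b ^ n + hookCoeff a b y m * hookCoeff a b y n +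
        y * (b ^ m * hookCoeff a b y n + hookCoeff a b y m * b ^ n)) := by
  have h := card_mul_stateSum_doubleTwist_card (Y := Fin y) m n a b
  rwa [pow_smul_one_add_smul hook_mul_hook, pow_smul_one_add_smul hook_mul_hook,
    closurePairing_one_add_hook, Fintype.card_fin] at h

theorem map_stateSum {R S : Type*} [CommSemiring R] [CommSemiring S] (φ : R →+* S) (D : LinkDiagram)
    (a b d : R) : φ (D.stateSum a b d) = D.stateSum (φ a) (φ b) (φ d) := by
  simp [stateSum, apply_ite φ]

theorem map_hookCoeff {R S : Type*} [CommSemiring R] [CommSemiring S] (φ : R →+* S)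
    (a b d : R) (m : ℕ) :
    φ (hookCoeff a b d m) = hookCoeff (φ a) (φ b) (φ d) m := by
  simp [hookCoeff]

theorem eq_of_forall_eval_natCast_eq {R : Type*} [CommRing R] [IsDomain R] [CharZero R]
    {P Q : Polynomial R} (h : ∀ y : ℕ, P.eval (y : R) = Q.eval (y : R)) : P = Q :=
  P.eq_of_infinite_eval_eq Q <|
    (Set.infinite_range_of_injective (Nat.cast_injective (R := R))).mono <|
      Set.range_subset_iff.2 h

theorem stateSum_doubleTwist (m n : ℕ) {R : Type*} [CommRing R] [IsDomain R] [CharZero R]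
    (a b d : R) :
    (doubleTwist m n).stateSum a b d = b ^ m * b ^ n + hookCoeff a b d m * hookCoeff a b d n +
      d * (b ^ m * hookCoeff a b d n + hookCoeff a b d m * b ^ n) := by
  let P : Polynomial R := (doubleTwist m n).stateSum (.C a) (.C b) .X
  let H (k : ℕ) : Polynomial R := hookCoeff (.C a) (.C b) .X k
  let Q : Polynomial R := .C b ^ m * .C b ^ n + H m * H n + .X * (.C b ^ m * H n + H m * .C b ^ n)
  have eval_P (x : R) : P.eval x = (doubleTwist m n).stateSum a b x := by
    simpa using map_stateSum (Polynomial.evalRingHom x) (doubleTwist m n) (.C a) (.C b) .X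
  have eval_H (x : R) (k : ℕ) : (H k).eval x = hookCoeff a b x k := by
    simpa using map_hookCoeff (Polynomial.evalRingHom x) (.C a) (.C b) .X k
  have h : Polynomial.X * P = .X * Q := eq_of_forall_eval_natCast_eq fun y => by
    simpa [Q, eval_P, eval_H] using mul_stateSum_doubleTwist_natCast m n a b y
  simpa [Q, eval_P, eval_H] using
    congrArg (Polynomial.eval d) (mul_left_cancel₀ Polynomial.X_ne_zero h)

end LinkDiagram

/-- The Kauffman bracket of the double twist diagram with columns of `m` and `n` positive half
twists is `A ^ (-m - n)` times the value of this polynomial at `-A ^ 4`. -/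
noncomputable def doubleTwistPolynomial (m n : ℕ) : Polynomial ℤ :=
  Polynomial.X ^ m + Polynomial.X ^ n - 1 - Polynomial.X *
    ((∑ k ∈ Finset.range m, Polynomial.X ^ k) * ∑ k ∈ Finset.range n, Polynomial.X ^ k)

theorem hookCoeff_of_mul_eq_one {R : Type*} [CommRing R] {a b : R} (hab : a * b = 1) (m : ℕ) :
    hookCoeff a b (-a ^ 2 - b ^ 2) m =
      a ^ 2 * b ^ m * ∑ k ∈ Finset.range m, (-a ^ 4) ^ k := by
  have hba : b + a * (-a ^ 2 - b ^ 2) = b * -a ^ 4 := by linear_combination (a ^ 3 - b) * hab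
  induction m with
  | zero => simp [hookCoeff]
  | succ m ih =>
    rw [hookCoeff_succ, ih, hba, geom_sum_succ]
    linear_combination (-a * b ^ m) * hab

theorem stateSum_doubleTwist_of_mul_eq_one {R : Type*} [CommRing R] [IsDomain R] [CharZero R]
    {a b : R} (hab : a * b = 1) (m n : ℕ) :
    (LinkDiagram.doubleTwist m n).stateSum a b (-a ^ 2 - b ^ 2) =
      b ^ (m + n) * ((-a ^ 4) ^ m + (-a ^ 4) ^ n - 1 - -a ^ 4 *
        ((∑ k ∈ Finset.range m, (-a ^ 4) ^ k) * ∑ k ∈ Finset.range n, (-a ^ 4) ^ k)) := by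
  have hd : (-a ^ 2 - b ^ 2) * a ^ 2 = -a ^ 4 - 1 := by linear_combination (-a * b - 1) * hab
  rw [LinkDiagram.stateSum_doubleTwist, hookCoeff_of_mul_eq_one hab, hookCoeff_of_mul_eq_one hab,
    ← sub_add_cancel ((-a ^ 4) ^ m) 1, ← sub_add_cancel ((-a ^ 4) ^ n) 1, ← geom_sum_mul,
    ← geom_sum_mul]
  generalize ∑ k ∈ Finset.range m, (-a ^ 4) ^ k = S, ∑ k ∈ Finset.range n, (-a ^ 4) ^ k = S'
  linear_combination (b ^ m * b ^ n * (S + S')) * hd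

theorem LinkDiagram.bracket_doubleTwist (m n : ℕ) :
    (doubleTwist m n).bracket = LaurentPolynomial.T (-(m + n : ℤ)) *
      Polynomial.aeval (-LaurentPolynomial.T 4 : ℤ[T;T⁻¹]) (doubleTwistPolynomial m n) := by
  have : CharZero ℤ[T;T⁻¹] := Algebra.charZero_of_charZero ℤ _
  have hab : (LaurentPolynomial.T 1 * LaurentPolynomial.T (-1) : ℤ[T;T⁻¹]) = 1 := by
    rw [← LaurentPolynomial.T_add, add_neg_cancel, LaurentPolynomial.T_zero]
  have hT (k : ℕ) : (LaurentPolynomial.T k : ℤ[T;T⁻¹]) = LaurentPolynomial.T 1 ^ k := by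
    rw [LaurentPolynomial.T_pow, mul_one]
  have hT' (k : ℕ) : (LaurentPolynomial.T (-k) : ℤ[T;T⁻¹]) = LaurentPolynomial.T (-1) ^ k := by
    rw [LaurentPolynomial.T_pow, mul_neg_one]
  have hd : (-LaurentPolynomial.T 2 - LaurentPolynomial.T (-2) : ℤ[T;T⁻¹]) =
      -LaurentPolynomial.T 1 ^ 2 - LaurentPolynomial.T (-1) ^ 2 :=
    congrArg₂ (- · - ·) (hT 2) (hT' 2)
  rw [bracket_eq_stateSum, hd, stateSum_doubleTwist_of_mul_eq_one hab, ← hT',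
    ← show LaurentPolynomial.T 4 = _ from hT 4, Nat.cast_add]
  simp [doubleTwistPolynomial]

theorem natDegree_geom_sum_X_add_one {R : Type*} [Ring R] [Nontrivial R] {m : ℕ} (hm : m ≠ 0) :
    (∑ k ∈ Finset.range m, (Polynomial.X : Polynomial R) ^ k).natDegree + 1 = m := by
  have h := congrArg Polynomial.natDegree (geom_sum_mul (Polynomial.X : Polynomial R) m)
  rwa [← Polynomial.C_1, (Polynomial.monic_geom_sum_X hm).natDegree_mul
    (Polynomial.monic_X_sub_C 1), Polynomial.natDegree_X_sub_C,
    Polynomial.natDegree_X_pow_sub_C] at h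

theorem monic_X_mul_geom_sum_mul_geom_sum {R : Type*} [Semiring R] {m n : ℕ} (hm : m ≠ 0)
    (hn : n ≠ 0) : (Polynomial.X * ((∑ k ∈ Finset.range m, (Polynomial.X : Polynomial R) ^ k) *
      ∑ k ∈ Finset.range n, Polynomial.X ^ k)).Monic :=
  Polynomial.monic_X.mul
    ((Polynomial.monic_geom_sum_X hm).mul (Polynomial.monic_geom_sum_X hn))

theorem natDegree_X_mul_geom_sum_mul_geom_sum_add_one {R : Type*} [Ring R] [Nontrivial R]
    {m n : ℕ} (hm : m ≠ 0) (hn : n ≠ 0) :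
    (Polynomial.X * ((∑ k ∈ Finset.range m, (Polynomial.X : Polynomial R) ^ k) *
      ∑ k ∈ Finset.range n, Polynomial.X ^ k)).natDegree + 1 = m + n := by
  have hM := Polynomial.monic_geom_sum_X (R := R) hm
  have hN := Polynomial.monic_geom_sum_X (R := R) hn
  rw [Polynomial.monic_X.natDegree_mul (hM.mul hN), hM.natDegree_mul hN, Polynomial.natDegree_X]
  linarith [natDegree_geom_sum_X_add_one (R := R) hm, natDegree_geom_sum_X_add_one (R := R) hn]

theorem coeff_zero_doubleTwistPolynomial {m n : ℕ} (hm : m ≠ 0) (hn : n ≠ 0) :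
    (doubleTwistPolynomial m n).coeff 0 = -1 := by
  simp [doubleTwistPolynomial, Polynomial.coeff_X_pow, hm.symm, hn.symm]

theorem natDegree_X_pow_add_X_pow_sub_one_lt {R : Type*} [Ring R] [Nontrivial R] {m n : ℕ}
    (hm : 1 < m) (hn : 1 < n) :
    (Polynomial.X ^ m + Polynomial.X ^ n - 1 : Polynomial R).natDegree <
      (Polynomial.X * ((∑ k ∈ Finset.range m, (Polynomial.X : Polynomial R) ^ k) *
        ∑ k ∈ Finset.range n, Polynomial.X ^ k)).natDegree := by
  have h := natDegree_X_mul_geom_sum_mul_geom_sum_add_one (R := R) (m := m) (n := n)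
    (by omega) (by omega)
  have hle : (Polynomial.X ^ m + Polynomial.X ^ n - 1 : Polynomial R).natDegree ≤ max m n := by
    compute_degree
  omega

theorem natDegree_doubleTwistPolynomial_add_one {m n : ℕ} (hm : 1 < m) (hn : 1 < n) :
    (doubleTwistPolynomial m n).natDegree + 1 = m + n := by
  rw [doubleTwistPolynomial, Polynomial.natDegree_sub_eq_right_of_natDegree_lt
    (natDegree_X_pow_add_X_pow_sub_one_lt hm hn)]
  exact natDegree_X_mul_geom_sum_mul_geom_sum_add_one (by omega) (by omega)

theorem leadingCoeff_doubleTwistPolynomial {m n : ℕ} (hm : 1 < m) (hn : 1 < n) :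
    (doubleTwistPolynomial m n).leadingCoeff = -1 := by
  rw [doubleTwistPolynomial, Polynomial.leadingCoeff_sub_of_degree_lt'
    (Polynomial.degree_lt_degree (natDegree_X_pow_add_X_pow_sub_one_lt hm hn)),
    monic_X_mul_geom_sum_mul_geom_sum (by omega) (by omega)]

theorem coeff_T_mul_aeval_neg_T_four {R : Type*} [CommRing R] (z : ℤ) (P : Polynomial R) (x : ℤ) :
    (LaurentPolynomial.T z * Polynomial.aeval (-LaurentPolynomial.T 4 : R[T;T⁻¹]) P).coeff x =
      ∑ k ∈ P.support, if z + 4 * k = x then (-1) ^ k * P.coeff k else 0 := by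
  have term (k : ℕ) : (LaurentPolynomial.T z *
      (algebraMap R R[T;T⁻¹] (P.coeff k) * (-LaurentPolynomial.T 4) ^ k) : R[T;T⁻¹]) =
        AddMonoidAlgebra.single (z + 4 * k) ((-1) ^ k * P.coeff k) := by
    rw [LaurentPolynomial.single_eq_C_mul_T, neg_pow, LaurentPolynomial.T_pow,
      LaurentPolynomial.T_add, mul_comm (k : ℤ) 4, map_mul, map_pow, map_neg, map_one,
      LaurentPolynomial.C_eq_algebraMap]
    ring
  rw [Polynomial.aeval_def, Polynomial.eval₂_eq_sum, Polynomial.sum_def, Finset.mul_sum,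
    AddMonoidAlgebra.coeff_sum, Finsupp.finsetSum_apply]
  exact Finset.sum_congr rfl fun k _ => by
    rw [term, AddMonoidAlgebra.coeff_single, Finsupp.single_apply]

theorem coeff_T_mul_aeval_neg_T_four_add {R : Type*} [CommRing R] (z : ℤ) (P : Polynomial R)
    (k : ℕ) : (LaurentPolynomial.T z *
      Polynomial.aeval (-LaurentPolynomial.T 4 : R[T;T⁻¹]) P).coeff (z + 4 * k) =
        (-1) ^ k * P.coeff k := by
  rw [coeff_T_mul_aeval_neg_T_four]
  simp +contextual

theorem setOf_coeff_T_mul_aeval_neg_T_four_ne_zero {R : Type*} [CommRing R] (z : ℤ)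
    (P : Polynomial R) :
    {x | (LaurentPolynomial.T z *
      Polynomial.aeval (-LaurentPolynomial.T 4 : R[T;T⁻¹]) P).coeff x ≠ 0} =
        (fun k : ℕ => z + 4 * k) '' {k | P.coeff k ≠ 0} := by
  ext x
  constructor
  · intro hx
    rw [Set.mem_ofPred_eq, coeff_T_mul_aeval_neg_T_four] at hx
    obtain ⟨k, hk, h⟩ := Finset.exists_ne_zero_of_sum_ne_zero hx
    exact ⟨k, Polynomial.mem_support_iff.1 hk, of_not_not fun hne => h (if_neg hne)⟩
  · rintro ⟨k, hk, rfl⟩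
    rw [Set.mem_ofPred_eq, coeff_T_mul_aeval_neg_T_four_add]
    simpa using hk

theorem monotone_add_four_mul_natCast (z : ℤ) : Monotone fun k : ℕ => z + 4 * k :=
  fun _ _ _ => by dsimp only; omega

theorem isLowestTerm_T_mul_aeval_neg_T_four (z : ℤ) {P : Polynomial ℤ} (hP : P.coeff 0 ≠ 0) :
    IsLowestTerm (LaurentPolynomial.T z *
      Polynomial.aeval (-LaurentPolynomial.T 4 : ℤ[T;T⁻¹]) P) z (P.coeff 0) := by
  have hleast : IsLeast {k | P.coeff k ≠ 0} 0 := ⟨hP, fun k _ => k.zero_le⟩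
  have h := (monotone_add_four_mul_natCast z).map_isLeast hleast
  rw [← setOf_coeff_T_mul_aeval_neg_T_four_ne_zero] at h
  have h' := coeff_T_mul_aeval_neg_T_four_add z P 0
  simp only [Nat.cast_zero, mul_zero, add_zero, pow_zero, one_mul] at h h'
  exact ⟨h, h'⟩

theorem isHighestTerm_T_mul_aeval_neg_T_four (z : ℤ) {P : Polynomial ℤ} (hP : P ≠ 0) :
    IsHighestTerm (LaurentPolynomial.T z *
      Polynomial.aeval (-LaurentPolynomial.T 4 : ℤ[T;T⁻¹]) P) (z + 4 * P.natDegree)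
        ((-1) ^ P.natDegree * P.leadingCoeff) := by
  have hgreatest : IsGreatest {k | P.coeff k ≠ 0} P.natDegree :=
    ⟨Polynomial.leadingCoeff_ne_zero.2 hP, fun _ => Polynomial.le_natDegree_of_ne_zero⟩
  have h := (monotone_add_four_mul_natCast z).map_isGreatest hgreatest
  rw [← setOf_coeff_T_mul_aeval_neg_T_four_ne_zero] at h
  exact ⟨h, coeff_T_mul_aeval_neg_T_four_add z P P.natDegree⟩

namespace LinkDiagram

theorem coeff_normalizedBracket (D : LinkDiagram) (o : D.Orientation) (x : ℤ) :
    (D.normalizedBracket o).coeff (x + 3 * o.writhe) =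
      o.writhe.negOnePow * D.bracket.coeff x := by
  rw [normalizedBracket, ← LaurentPolynomial.single_eq_C_mul_T, add_comm x]
  exact D.bracket.coeff_single_mul_add _ _ _

theorem coeff_jones (D : LinkDiagram) (o : D.Orientation) (x : ℤ) :
    (D.jones o).coeff ((x : ℚ) / 4) = (D.normalizedBracket o).coeff x := by
  refine Finsupp.mapDomain_apply (fun x y h => ?_) _ _
  exact Int.cast_injective ((div_left_inj' (four_ne_zero' ℚ)).1 h)

theorem setOf_coeff_jones_ne_zero (D : LinkDiagram) (o : D.Orientation) :
    {x | (D.jones o).coeff x ≠ 0} =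
      (fun x : ℤ => ((x + 3 * o.writhe : ℤ) : ℚ) / 4) '' {x | D.bracket.coeff x ≠ 0} := by
  have hcoeff (x : ℤ) : (D.jones o).coeff (((x + 3 * o.writhe : ℤ) : ℚ) / 4) ≠ 0 ↔
      D.bracket.coeff x ≠ 0 := by
    rw [coeff_jones, coeff_normalizedBracket]
    simp
  ext x
  constructor
  · intro hx
    obtain ⟨y, rfl⟩ := Finsupp.mem_range_of_mapDomain_ne_zero hx
    refine ⟨y - 3 * o.writhe, (hcoeff _).1 ?_, by simp⟩
    rwa [sub_add_cancel]
  · rintro ⟨y, hy, rfl⟩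
    exact (hcoeff y).2 hy

theorem hasSpan_jones (D : LinkDiagram) (o : D.Orientation) {a b c c' : ℤ}
    (ha : IsLowestTerm D.bracket a c) (hb : IsHighestTerm D.bracket b c') :
    HasSpan (D.jones o) (((b : ℚ) - a) / 4 + 1) := by
  have hmono : Monotone fun x : ℤ => ((x + 3 * o.writhe : ℤ) : ℚ) / 4 := fun x y h => by
    dsimp only
    gcongr
  refine ⟨_, _, D.setOf_coeff_jones_ne_zero o ▸ hmono.map_isLeast ha.1,
    D.setOf_coeff_jones_ne_zero o ▸ hmono.map_isGreatest hb.1, ?_⟩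
  push_cast
  ring

theorem isLowestTerm_bracket_doubleTwist {m n : ℕ} (hm : m ≠ 0) (hn : n ≠ 0) :
    IsLowestTerm (doubleTwist m n).bracket (-(m + n)) (-1) := by
  have h0 := coeff_zero_doubleTwistPolynomial hm hn
  rw [bracket_doubleTwist, ← h0]
  exact isLowestTerm_T_mul_aeval_neg_T_four _ (by simp [h0])

theorem isHighestTerm_bracket_doubleTwist {m n : ℕ} (hm : 1 < m) (hn : 1 < n) :
    IsHighestTerm (doubleTwist m n).bracket (3 * (m + n) - 4) ((-1) ^ (m + n)) := by
  have hdeg := natDegree_doubleTwistPolynomial_add_one hm hn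
  have hlead := leadingCoeff_doubleTwistPolynomial hm hn
  have h := isHighestTerm_T_mul_aeval_neg_T_four (-(m + n : ℤ))
    (Polynomial.leadingCoeff_ne_zero.1 (by rw [hlead]; decide))
  rw [← bracket_doubleTwist, hlead, ← pow_succ, hdeg] at h
  convert h using 1
  omega

end LinkDiagram

theorem lemma3p9 (p q : ℤ) (hp : 1 < p) (hq : 1 < q) :
    IsLowestTerm (LinkDiagram.doubleTwist p q).bracket (-p - q) (-1) ∧
    IsHighestTerm (LinkDiagram.doubleTwist p q).bracket (3 * (p + q) - 4)
      ((p + q).negOnePow : ℤ) ∧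
    ∀ o : (LinkDiagram.doubleTwist p q).Orientation,
      HasSpan ((LinkDiagram.doubleTwist p q).jones o) ((p : ℚ) + q) := by
  lift p to ℕ using by omega
  lift q to ℕ using by omega
  rw [Nat.one_lt_cast] at hp hq
  have hlow := LinkDiagram.isLowestTerm_bracket_doubleTwist hp.ne_bot hq.ne_bot
  have hhigh := LinkDiagram.isHighestTerm_bracket_doubleTwist hp hq
  refine ⟨?_, ?_, fun o => ?_⟩
  · rwa [neg_add'] at hlow
  · rwa [← Nat.cast_add, Int.coe_negOnePow_natCast]
  · convert LinkDiagram.hasSpan_jones _ o hlow hhigh using 1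
    push_cast
    ring
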